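/- Let $d,N\in\mathbb N$. For a Euclidean space $X$ let $\mathcal P_2(X)$ be the set of Borel probability measures on $X$ with finite second moment, let $\Gamma(\mu,\nu)$ be the set of couplings of $\mu,\nu\in\mathcal P_2(X)$, let $W_2(\mu,\nu)=\big(\inf_{\gamma\in\Gamma(\mu,\nu)}\int|x-y|^2\,d\gamma(x,y)\big)^{1/2}$, and let $\Gamma_o(\mu,\nu)\subseteq\Gamma(\mu,\nu)$ be the set of couplings minimizing $\int|x-y|^2\,d\gamma$. For a set $A\subseteq\mathcal P_2(X)$ put $\Gamma_o(\mu,A)=\bigcup_{\nu\in A}\Gamma_o(\mu,\nu)$. For a finite Borel measure $\mathbb Q$ on $\mathcal P_2(\mathbb R^d)$ let $$\mathrm{Bar}(\mathbb Q)=\operatorname*{argmin}_{\nu\in\mathcal P_2(\mathbb R^d)}\int W_2^2(\sigma,\nu)\,\mathbb Q(d\sigma).$$ Let $\lambda:\mathcal P_2(\mathbb R^d)\to(0,\infty)$ be bounded and continuous with respect to $W_2$. For $\mu\in\mathcal P_2((\mathbb R^d)^N)$ with marginals $\mu^1,\dots,\mu^N\in\mathcal P_2(\mathbb R^d)$ let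 $\mathbb P_\mu=\frac1N\sum_{i=1}^N\delta_{\mu^i}$, let $\lambda\mathbb P_\mu$ be the measure with density $\lambda$ with respect to $\mathbb P_\mu$, and define the multivalued probability vector field $\mathcal V:\mathcal P_2((\mathbb R^d)^N)\rightrightarrows\mathcal P_2(\mathrm T(\mathbb R^d)^N)$, where $\mathrm T(\mathbb R^d)^N=(\mathbb R^d)^N\times(\mathbb R^d)^N\cong(\mathrm T\mathbb R^d)^N$, by $$\mathcal V[\mu]=\bigotimes_{i=1}^N(\pi_0,\pi_1-\pi_0)_\#\Gamma_o\big(\mu^i,\mathrm{Bar}(\lambda\mathbb P_\mu)\big)=\Big\{\bigotimes_{i=1}^N(\pi_0,\pi_1-\pi_0)_\#\gamma^i:\ \gamma^i\in\Gamma_o\big(\mu^i,\mathrm{Bar}(\lambda\mathbb P_\mu)\big),\ i=1,\dots,N\Big\},$$ where $\pi_0(x,y)=x$ and $\pi_1(x,y)=y$. Then $\mathcal V$ is upper semicontinuous, i.e. its graph is closed: if $\mu_n\to\mu$ in $(\mathcal P_2((\mathbb R^d)^N),W_2)$, $\rho_n\to\rho$ in $(\mathcal P_2(\mathrm T(\mathbb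 R^d)^N),W_2)$ and $\rho_n\in\mathcal V[\mu_n]$ for all $n$, then $\rho\in\mathcal V[\mu]$. The same holds for the variant of $\mathcal V$ in which all the $\gamma^i$ are required to be optimal couplings of $\mu^i$ with one common barycenter $\nu\in\mathrm{Bar}(\lambda\mathbb P_\mu)$. -/

import Mathlib

open MeasureTheory Filter Topology
open scoped ENNReal BoundedContinuousFunction

/-- The space `𝒫₂(X)` of Borel probability measures on `X` with finite second moment. -/
@[ext]
structure P2 (X : Type*) [NormedAddCommGroup X] [MeasurableSpace X] where
  /-- the underlying Borel measure -/
  toMeasure : Measure X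
  isProbabilityMeasure : IsProbabilityMeasure toMeasure
  secondMoment_lt_top : ∫⁻ x, ‖x‖ₑ ^ 2 ∂toMeasure < ⊤

section Transport

variable {X : Type*} [NormedAddCommGroup X] [MeasurableSpace X]

/-- The set `Γ(μ, ν)` of couplings: measures on `X × X` with marginals `μ` and `ν`
(these are automatically probability measures). -/
def couplings (μ ν : P2 X) : Set (Measure (X × X)) :=
  {γ | γ.map Prod.fst = μ.toMeasure ∧ γ.map Prod.snd = ν.toMeasure}

/-- The quadratic transport cost `∫ |x - y|² dγ(x, y)` of a plan `γ`. -/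
noncomputable def quadraticCost (γ : Measure (X × X)) : ℝ≥0∞ :=
  ∫⁻ p, ‖p.1 - p.2‖ₑ ^ 2 ∂γ

/-- The `2`-Wasserstein distance, with values in `[0, ∞]`
(it is in fact finite, because of the finite second moments). -/
noncomputable def W2 (μ ν : P2 X) : ℝ≥0∞ :=
  (⨅ γ ∈ couplings μ ν, quadraticCost γ) ^ (1 / 2 : ℝ)

/-- The set `Γ_o(μ, ν)` of optimal couplings for the quadratic cost. -/
def optimalCouplings (μ ν : P2 X) : Set (Measure (X × X)) :=
  {γ | γ ∈ couplings μ ν ∧ IsMinOn quadraticCost (couplings μ ν) γ}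

/-- `Γ_o(μ, A)` for a set `A` of measures: the optimal couplings of `μ` with some element
of `A`. -/
def optimalCouplingsSet (μ : P2 X) (A : Set (P2 X)) : Set (Measure (X × X)) :=
  ⋃ ν ∈ A, optimalCouplings μ ν

/-- The topology of `𝒫₂(X)` induced by the Wasserstein distance: a set is open if with each of its
points it contains a Wasserstein ball around that point. -/
instance P2.instTopologicalSpace : TopologicalSpace (P2 X) where
  IsOpen U := ∀ μ ∈ U, ∃ ε : ℝ≥0∞, 0 < ε ∧ ∀ ν, W2 μ ν < ε → ν ∈ U
  isOpen_univ := fun _ _ => ⟨1, one_pos, fun _ _ => trivial⟩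
  isOpen_inter := by
    rintro U V hU hV μ ⟨hμU, hμV⟩
    obtain ⟨ε, hε, hεU⟩ := hU μ hμU
    obtain ⟨δ, hδ, hδV⟩ := hV μ hμV
    exact ⟨min ε δ, lt_min hε hδ, fun ν hν =>
      ⟨hεU ν (hν.trans_le (min_le_left _ _)), hδV ν (hν.trans_le (min_le_right _ _))⟩⟩
  isOpen_sUnion := by
    rintro S hS μ ⟨U, hUS, hμU⟩
    obtain ⟨ε, hε, hεU⟩ := hS U hUS μ hμU
    exact ⟨ε, hε, fun ν hν => ⟨U, hUS, hεU ν hν⟩⟩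

/-- `𝒫₂(X)` carries the Borel `σ`-algebra of the Wasserstein topology. -/
instance P2.instMeasurableSpace : MeasurableSpace (P2 X) := borel (P2 X)

/-- The set `Bar(ℚ)` of Wasserstein barycenters of a measure `ℚ` on `𝒫₂(X)`: the minimizers over
`ν ∈ 𝒫₂(X)` of `∫ W₂²(σ, ν) dℚ(σ)`. -/
def Bar (Q : Measure (P2 X)) : Set (P2 X) :=
  {ν | IsMinOn (fun ν' : P2 X => ∫⁻ σ, W2 σ ν' ^ 2 ∂Q) Set.univ ν}

/-- Convergence of a sequence in the Wasserstein distance. -/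
def ConvergesW2 (μ : ℕ → P2 X) (μ' : P2 X) : Prop :=
  Tendsto (fun n => W2 (μ n) μ') atTop (𝓝 0)

/-- Upper semicontinuity of a multivalued map between Wasserstein spaces: its graph is
(sequentially) closed. -/
def UpperSemicontinuousMV {Y : Type*} [NormedAddCommGroup Y] [MeasurableSpace Y]
    (F : P2 X → Set (P2 Y)) : Prop :=
  ∀ (μ : ℕ → P2 X) (ρ : ℕ → P2 Y) (μ' : P2 X) (ρ' : P2 Y),
    ConvergesW2 μ μ' → ConvergesW2 ρ ρ' → (∀ n, ρ n ∈ F (μ n)) → ρ' ∈ F μ'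

end Transport

/-- `ℝᵈ` with the Euclidean norm. -/
abbrev Rd (d : ℕ) : Type := EuclideanSpace ℝ (Fin d)

/-- `(ℝᵈ)ᴺ` with the Euclidean norm. -/
abbrev RdN (d N : ℕ) : Type := PiLp 2 (fun _ : Fin N => Rd d)

/-- The tangent bundle `T(ℝᵈ)ᴺ = (ℝᵈ)ᴺ × (ℝᵈ)ᴺ` with the Euclidean norm; its elements are pairs
(position, velocity). -/
abbrev TRdN (d N : ℕ) : Type := WithLp 2 (RdN d N × RdN d N)

/-- The `i`-th marginal `μⁱ = (pᵢ)_# μ` of `μ ∈ 𝒫₂((ℝᵈ)ᴺ)`. -/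
noncomputable def P2.marginal {d N : ℕ} (μ : P2 (RdN d N)) (i : Fin N) : P2 (Rd d) where
  toMeasure := μ.toMeasure.map (fun x => x i)
  isProbabilityMeasure :=
    haveI := μ.isProbabilityMeasure
    Measure.isProbabilityMeasure_map (by fun_prop)
  secondMoment_lt_top := by
    rw [lintegral_map (by fun_prop) (by fun_prop)]
    refine lt_of_le_of_lt (lintegral_mono fun x => ?_) μ.secondMoment_lt_top
    gcongr
    exact enorm_le_iff_norm_le.mpr (PiLp.norm_apply_le x i)

/-- The empirical measure `ℙ_μ = (1/N) ∑ᵢ δ_{μⁱ}` on `𝒫₂(ℝᵈ)` of `μ ∈ 𝒫₂((ℝᵈ)ᴺ)`. -/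
noncomputable def empirical {d N : ℕ} (μ : P2 (RdN d N)) : Measure (P2 (Rd d)) :=
  (N : ℝ≥0∞)⁻¹ • ∑ i, Measure.dirac (μ.marginal i)

/-- The weighted measure `λ ℚ`, with density `λ` with respect to `ℚ`. -/
noncomputable def weighted {d : ℕ} (lam : P2 (Rd d) →ᵇ ℝ) (Q : Measure (P2 (Rd d))) :
    Measure (P2 (Rd d)) :=
  Q.withDensity (fun σ => ENNReal.ofReal (lam σ))

/-- The push-forward `(π₀, π₁ - π₀)_# γ`, a measure on `Tℝᵈ = ℝᵈ × ℝᵈ`. -/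
noncomputable def velocityPlan {d : ℕ} (γ : Measure (Rd d × Rd d)) : Measure (Rd d × Rd d) :=
  γ.map (fun p => (p.1, p.2 - p.1))

/-- The identification of `(Tℝᵈ)ᴺ` with `T(ℝᵈ)ᴺ`,
`((x₁, v₁), …, (x_N, v_N)) ↦ ((x₁, …, x_N), (v₁, …, v_N))`. -/
noncomputable def tangentIdent {d N : ℕ} (z : Fin N → Rd d × Rd d) : TRdN d N :=
  WithLp.toLp 2 (WithLp.toLp 2 (fun i => (z i).1), WithLp.toLp 2 (fun i => (z i).2))

/-- The product `⨂ᵢ ηᵢ` of measures `ηᵢ` on `Tℝᵈ`, as a measure on `T(ℝᵈ)ᴺ`. -/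
noncomputable def tensor {d N : ℕ} (η : Fin N → Measure (Rd d × Rd d)) : Measure (TRdN d N) :=
  (Measure.pi η).map tangentIdent

/-- The multivalued probability vector field
`𝒱[μ] = ⨂ᵢ (π₀, π₁ - π₀)_# Γ_o(μⁱ, Bar(λ ℙ_μ))`: the product of the sets
`(π₀, π₁ - π₀)_# Γ_o(μⁱ, Bar(λ ℙ_μ))`. -/
def multiVF {d N : ℕ} (lam : P2 (Rd d) →ᵇ ℝ) (μ : P2 (RdN d N)) : Set (P2 (TRdN d N)) :=
  {ρ | ∃ γ : Fin N → Measure (Rd d × Rd d),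
    (∀ i, γ i ∈ optimalCouplingsSet (μ.marginal i) (Bar (weighted lam (empirical μ)))) ∧
    ρ.toMeasure = tensor (fun i => velocityPlan (γ i))}

/-- The variant of `multiVF` in which all agents use one common barycenter
`ν ∈ Bar(λ ℙ_μ)`. The two differ only if the barycenter is not unique. -/
def multiVFCommon {d N : ℕ} (lam : P2 (Rd d) →ᵇ ℝ) (μ : P2 (RdN d N)) : Set (P2 (TRdN d N)) :=
  {ρ | ∃ ν ∈ Bar (weighted lam (empirical μ)), ∃ γ : Fin N → Measure (Rd d × Rd d),
    (∀ i, γ i ∈ optimalCouplings (μ.marginal i) ν) ∧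
    ρ.toMeasure = tensor (fun i => velocityPlan (γ i))}

/-!
Couplings of two measures can be glued along a common marginal, so `W2` is a metric on `P2 X`, and
it is stronger than weak convergence. Closedness of the graph of `𝒱` then comes from continuity in
the Wasserstein metric. A measure `ρ` on `T(ℝᵈ)ᴺ` determines the plans it is built from: the plan
of component `i` is the law of `(xᵢ, xᵢ + vᵢ)` under `ρ`, so its second marginal is the barycenter
and depends continuously on `ρ`; no compactness argument is needed. The plan is optimal iff the
second moment of the law of `vᵢ`, which is its squared Wasserstein distance to `δ₀`, does not exceed
the squared distance between the two marginals, an inequality between continuous functions. Being a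
barycenter is a family of inequalities between functions that are jointly continuous in weights,
atoms and candidate, and being a product measure is an equation between weakly continuous functions
of `ρ`.
-/

namespace P2

variable {X : Type*} [NormedAddCommGroup X] [MeasurableSpace X]

instance instIsProbabilityMeasure (μ : P2 X) : IsProbabilityMeasure μ.toMeasure :=
  μ.isProbabilityMeasure

end P2

theorem memLp_two_iff_lintegral_enorm_sq_lt_top {X : Type*} [NormedAddCommGroup X] {Ω : Type*}
    [MeasurableSpace Ω] {π : Measure Ω} {f : Ω → X} (hf : AEStronglyMeasurable f π) :
    MemLp f 2 π ↔ ∫⁻ ω, ‖f ω‖ₑ ^ 2 ∂π < ⊤ := by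
  have h := eLpNorm_lt_top_iff_lintegral_rpow_enorm_lt_top (μ := π) (f := f) two_ne_zero
    ENNReal.ofNat_ne_top
  simp only [ENNReal.toReal_ofNat, ENNReal.rpow_ofNat] at h
  rw [← h, MemLp, and_iff_right hf]

section WassersteinDistance

variable {X : Type*} [NormedAddCommGroup X] [MeasurableSpace X] {μ ν : P2 X}

theorem isProbabilityMeasure_of_mem_couplings {γ : Measure (X × X)} (hγ : γ ∈ couplings μ ν) :
    IsProbabilityMeasure γ :=
  have : IsProbabilityMeasure (γ.map Prod.fst) := hγ.1 ▸ μ.isProbabilityMeasure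
  Measure.isProbabilityMeasure_of_map Prod.fst

theorem measurePreserving_fst_of_mem_couplings {γ : Measure (X × X)} (hγ : γ ∈ couplings μ ν) :
    MeasurePreserving Prod.fst γ μ.toMeasure :=
  ⟨measurable_fst, hγ.1⟩

theorem measurePreserving_snd_of_mem_couplings {γ : Measure (X × X)} (hγ : γ ∈ couplings μ ν) :
    MeasurePreserving Prod.snd γ ν.toMeasure :=
  ⟨measurable_snd, hγ.2⟩

theorem prod_mem_couplings (μ ν : P2 X) : μ.toMeasure.prod ν.toMeasure ∈ couplings μ ν :=
  ⟨measurePreserving_fst.map_eq, measurePreserving_snd.map_eq⟩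

instance couplings.instNonempty (μ ν : P2 X) : Nonempty (couplings μ ν) :=
  ⟨⟨_, prod_mem_couplings μ ν⟩⟩

theorem map_prodMk_mem_couplings_iff {Ω : Type*} [MeasurableSpace Ω] {π : Measure Ω} {f g : Ω → X}
    (hf : Measurable f) (hg : Measurable g) :
    π.map (fun ω => (f ω, g ω)) ∈ couplings μ ν ↔
      π.map f = μ.toMeasure ∧ π.map g = ν.toMeasure := by
  rw [couplings, Set.mem_ofPred_eq, Measure.map_map measurable_fst (hf.prodMk hg),
    Measure.map_map measurable_snd (hf.prodMk hg)]
  rfl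

theorem quadraticCost_rpow_half (γ : Measure (X × X)) :
    quadraticCost γ ^ (1 / 2 : ℝ) = eLpNorm (Prod.fst - Prod.snd) 2 γ := by
  rw [eLpNorm_eq_lintegral_rpow_enorm_toReal two_ne_zero ENNReal.ofNat_ne_top]
  simp [quadraticCost]

theorem W2_eq_iInf_eLpNorm (μ ν : P2 X) :
    W2 μ ν = ⨅ γ : couplings μ ν, eLpNorm (Prod.fst - Prod.snd) 2 γ.1 := by
  simp only [W2, ← quadraticCost_rpow_half, iInf_subtype']
  exact (ENNReal.orderIsoRpow (1 / 2) one_half_pos).map_iInf _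

theorem mem_optimalCouplings_iff {γ : Measure (X × X)} :
    γ ∈ optimalCouplings μ ν ↔
      γ ∈ couplings μ ν ∧ eLpNorm (Prod.fst - Prod.snd) 2 γ ≤ W2 μ ν := by
  refine and_congr_right fun _ => ?_
  rw [← quadraticCost_rpow_half, W2, ENNReal.rpow_le_rpow_iff one_half_pos, isMinOn_iff,
    le_iInf₂_iff]

variable [BorelSpace X] [SecondCountableTopology X]

theorem P2.memLp_id (μ : P2 X) : MemLp id 2 μ.toMeasure :=
  (memLp_two_iff_lintegral_enorm_sq_lt_top aestronglyMeasurable_id).2 μ.secondMoment_lt_top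

theorem eLpNorm_sub_map_prodMk {Ω : Type*} [MeasurableSpace Ω] {π : Measure Ω} {f g : Ω → X}
    (hf : Measurable f) (hg : Measurable g) :
    eLpNorm (Prod.fst - Prod.snd) 2 (π.map fun ω => (f ω, g ω)) = eLpNorm (f - g) 2 π :=
  eLpNorm_map_measure (by fun_prop) (by fun_prop)

theorem W2_le_eLpNorm_sub {Ω : Type*} [MeasurableSpace Ω] {π : Measure Ω} {f g : Ω → X}
    (hf : MeasurePreserving f π μ.toMeasure) (hg : MeasurePreserving g π ν.toMeasure) :
    W2 μ ν ≤ eLpNorm (f - g) 2 π := by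
  have hγ := (map_prodMk_mem_couplings_iff hf.measurable hg.measurable).2 ⟨hf.map_eq, hg.map_eq⟩
  rw [W2_eq_iInf_eLpNorm, ← eLpNorm_sub_map_prodMk hf.measurable hg.measurable]
  exact iInf_le (fun γ : couplings μ ν => eLpNorm (Prod.fst - Prod.snd) 2 γ.1) ⟨_, hγ⟩

theorem W2_ne_top (μ ν : P2 X) : W2 μ ν ≠ ⊤ := by
  have hfst : MeasurePreserving Prod.fst (μ.toMeasure.prod ν.toMeasure) μ.toMeasure :=
    measurePreserving_fst
  have hsnd : MeasurePreserving Prod.snd (μ.toMeasure.prod ν.toMeasure) ν.toMeasure :=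
    measurePreserving_snd
  exact ne_top_of_le_ne_top ((μ.memLp_id.comp_measurePreserving hfst).sub
    (ν.memLp_id.comp_measurePreserving hsnd)).eLpNorm_ne_top (W2_le_eLpNorm_sub hfst hsnd)

theorem W2_self (μ : P2 X) : W2 μ μ = 0 := by
  simpa using W2_le_eLpNorm_sub (.id μ.toMeasure) (.id μ.toMeasure)

theorem W2_le_W2_swap (μ ν : P2 X) : W2 μ ν ≤ W2 ν μ := by
  rw [W2_eq_iInf_eLpNorm ν μ]
  refine le_iInf fun γ => ?_
  rw [eLpNorm_sub_comm]
  exact W2_le_eLpNorm_sub (measurePreserving_snd_of_mem_couplings γ.2)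
    (measurePreserving_fst_of_mem_couplings γ.2)

theorem W2_comm (μ ν : P2 X) : W2 μ ν = W2 ν μ :=
  (W2_le_W2_swap μ ν).antisymm (W2_le_W2_swap ν μ)

end WassersteinDistance

section Gluing

open ProbabilityTheory

variable {α β δ : Type*} [MeasurableSpace α] [MeasurableSpace β] [MeasurableSpace δ]

theorem map_compProd_comap {π : Measure α} [SFinite π] {f : α → β} (hf : Measurable f)
    (κ : Kernel β δ) [IsSFiniteKernel κ] :
    (π ⊗ₘ κ.comap f hf).map (Prod.map f id) = π.map f ⊗ₘ κ := by
  ext s hs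
  rw [Measure.map_apply (by fun_prop) hs, Measure.compProd_apply (by measurability),
    Measure.compProd_apply hs, lintegral_map (Kernel.measurable_kernel_prodMk_left hs) hf]
  rfl

theorem exists_gluing [StandardBorelSpace α] [Nonempty α] {γ : Measure (α × β)}
    {γ' : Measure (β × δ)} [IsFiniteMeasure γ] [SFinite γ']
    (h : γ.map Prod.snd = γ'.map Prod.fst) :
    ∃ π : Measure (α × β × δ),
      π.map (fun p => (p.1, p.2.1)) = γ ∧ π.map Prod.snd = γ' := by
  set κ := (γ.map Prod.swap).condKernel
  refine ⟨(γ' ⊗ₘ κ.comap Prod.fst measurable_fst).map Prod.swap, ?_, ?_⟩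
  · have hβ : (γ.map Prod.swap).fst = γ'.map Prod.fst := by
      rw [Measure.fst, Measure.map_map measurable_fst measurable_swap, ← h]
      rfl
    calc ((γ' ⊗ₘ κ.comap Prod.fst measurable_fst).map Prod.swap).map (fun p => (p.1, p.2.1))
        = ((γ' ⊗ₘ κ.comap Prod.fst measurable_fst).map (Prod.map Prod.fst id)).map Prod.swap := by
          rw [Measure.map_map (by fun_prop) measurable_swap,
            Measure.map_map measurable_swap (by fun_prop)]
          rfl
      _ = (γ.map Prod.swap).map Prod.swap := by
          rw [map_compProd_comap, ← hβ, Measure.disintegrate]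
      _ = γ := by
          rw [Measure.map_map measurable_swap measurable_swap, Prod.swap_swap_eq, Measure.map_id]
  · rw [Measure.map_map measurable_snd measurable_swap]
    exact Measure.fst_compProd γ' _

end Gluing

section MetricSpace

variable {X : Type*} [NormedAddCommGroup X] [MeasurableSpace X] [BorelSpace X]
  [SecondCountableTopology X]

theorem W2_triangle [CompleteSpace X] (μ ν σ : P2 X) : W2 μ σ ≤ W2 μ ν + W2 ν σ := by
  rw [W2_eq_iInf_eLpNorm μ ν, W2_eq_iInf_eLpNorm ν σ]
  refine ENNReal.le_iInf_add_iInf fun ⟨γ, hγ⟩ ⟨γ', hγ'⟩ => ?_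
  have := isProbabilityMeasure_of_mem_couplings hγ
  have := isProbabilityMeasure_of_mem_couplings hγ'
  obtain ⟨π, hπγ, hπγ'⟩ := exists_gluing (hγ.2.trans hγ'.1.symm)
  have hleft : MeasurePreserving (fun p : X × X × X => (p.1, p.2.1)) π γ := ⟨by fun_prop, hπγ⟩
  have hright : MeasurePreserving Prod.snd π γ' := ⟨measurable_snd, hπγ'⟩
  calc W2 μ σ
      ≤ eLpNorm (Prod.fst - fun p : X × X × X => p.2.2) 2 π :=
        W2_le_eLpNorm_sub ((measurePreserving_fst_of_mem_couplings hγ).comp hleft)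
          ((measurePreserving_snd_of_mem_couplings hγ').comp hright)
    _ = eLpNorm ((Prod.fst - Prod.snd) ∘ (fun p : X × X × X => (p.1, p.2.1)) +
          (Prod.fst - Prod.snd) ∘ Prod.snd) 2 π := by
        congr 1
        ext p
        simp
    _ ≤ eLpNorm ((Prod.fst - Prod.snd) ∘ (fun p : X × X × X => (p.1, p.2.1))) 2 π +
          eLpNorm ((Prod.fst - Prod.snd) ∘ Prod.snd) 2 π :=
        eLpNorm_add_le (by fun_prop) (by fun_prop) one_le_two
    _ = eLpNorm (Prod.fst - Prod.snd) 2 γ + eLpNorm (Prod.fst - Prod.snd) 2 γ' := by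
        rw [eLpNorm_comp_measurePreserving (by fun_prop) hleft,
          eLpNorm_comp_measurePreserving (by fun_prop) hright]

theorem edist_integral_le_mul_W2 (μ ν : P2 X) (f : X →ᵇ ℝ) {K : NNReal} (hf : LipschitzWith K f) :
    edist (∫ x, f x ∂μ.toMeasure) (∫ x, f x ∂ν.toMeasure) ≤ K * W2 μ ν := by
  rw [W2_eq_iInf_eLpNorm, ENNReal.mul_iInf (by simp)]
  refine le_iInf fun ⟨γ, hγ⟩ => ?_
  have := isProbabilityMeasure_of_mem_couplings hγ
  have hfst := measurePreserving_fst_of_mem_couplings hγ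
  have hsnd := measurePreserving_snd_of_mem_couplings hγ
  calc edist (∫ x, f x ∂μ.toMeasure) (∫ x, f x ∂ν.toMeasure)
      = ‖∫ p : X × X, f p.1 - f p.2 ∂γ‖ₑ := by
        have hint₁ : Integrable (fun p : X × X => f p.1) γ :=
          hfst.integrable_comp_of_integrable (f.integrable _)
        have hint₂ : Integrable (fun p : X × X => f p.2) γ :=
          hsnd.integrable_comp_of_integrable (f.integrable _)
        have hf : StronglyMeasurable f := f.continuous.stronglyMeasurable
        rw [integral_sub hint₁ hint₂, edist_eq_enorm_sub, ← hfst.map_eq, ← hsnd.map_eq,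
          integral_map (by fun_prop) hf.aestronglyMeasurable,
          integral_map (by fun_prop) hf.aestronglyMeasurable]
    _ ≤ ∫⁻ p : X × X, ‖f p.1 - f p.2‖ₑ ∂γ := enorm_integral_le_lintegral_enorm _
    _ ≤ ∫⁻ p : X × X, K * ‖p.1 - p.2‖ₑ ∂γ := by
        gcongr with p
        simpa only [edist_eq_enorm_sub] using hf p.1 p.2
    _ = K * eLpNorm (Prod.fst - Prod.snd) 1 γ := by
        rw [lintegral_const_mul _ (by fun_prop), eLpNorm_one_eq_lintegral_enorm]
        rfl
    _ ≤ K * eLpNorm (Prod.fst - Prod.snd) 2 γ := by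
        gcongr
        exact eLpNorm_le_eLpNorm_of_exponent_le one_le_two (by fun_prop)

namespace P2

/-- A measure of `𝒫₂(X)`, as a point of the space of probability measures with the topology of
weak convergence. -/
def toProbabilityMeasure (μ : P2 X) : ProbabilityMeasure X :=
  ⟨μ.toMeasure, μ.isProbabilityMeasure⟩

theorem tendsto_toProbabilityMeasure {ι : Type*} {l : Filter ι} [l.IsCountablyGenerated]
    {μ : ι → P2 X} {ν : P2 X} (h : Tendsto (fun i => W2 (μ i) ν) l (𝓝 0)) :
    Tendsto (fun i => (μ i).toProbabilityMeasure) l (𝓝 ν.toProbabilityMeasure) := by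
  rw [tendsto_iff_forall_lipschitz_integral_tendsto]
  rintro f ⟨C, hC⟩ ⟨K, hK⟩
  rw [tendsto_iff_edist_tendsto_0]
  have hlim : Tendsto (fun i => K * W2 (μ i) ν) l (𝓝 0) := by
    simpa using ENNReal.Tendsto.const_mul h (.inr ENNReal.coe_ne_top)
  exact tendsto_of_tendsto_of_tendsto_of_le_of_le tendsto_const_nhds hlim (fun _ => zero_le)
    fun i => edist_integral_le_mul_W2 (μ i) ν (.mkOfBound ⟨f, hK.continuous⟩ C hC) hK

theorem eq_of_W2_eq_zero {μ ν : P2 X} (h : W2 μ ν = 0) : μ = ν := by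
  have hlim : Tendsto (fun _ : ℕ => μ.toProbabilityMeasure) atTop (𝓝 ν.toProbabilityMeasure) :=
    tendsto_toProbabilityMeasure (by simp [h])
  have heq := tendsto_nhds_unique tendsto_const_nhds hlim
  exact P2.ext (congrArg Subtype.val heq)

variable [CompleteSpace X]

/-- The Wasserstein metric; `replaceTopology` makes its topology definitionally equal to
`P2.instTopologicalSpace`. -/
noncomputable instance instMetricSpace : MetricSpace (P2 X) :=
  letI m : EMetricSpace (P2 X) :=
    { edist := W2
      edist_self := W2_self
      edist_comm := W2_comm
      edist_triangle := W2_triangle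
      eq_of_edist_eq_zero := eq_of_W2_eq_zero }
  letI : EMetricSpace (P2 X) := m.replaceTopology <| TopologicalSpace.ext_iff.2 fun U => by
    rw [EMetric.isOpen_iff]
    simp only [Set.subset_def, Metric.mem_eball, edist_comm _ (_ : P2 X)]
    rfl
  EMetricSpace.toMetricSpace W2_ne_top

instance instBorelSpace : BorelSpace (P2 X) := ⟨rfl⟩

theorem edist_eq_W2 (μ ν : P2 X) : edist μ ν = W2 μ ν := rfl

theorem continuous_toProbabilityMeasure : Continuous (toProbabilityMeasure (X := X)) :=
  continuous_iff_continuousAt.2 fun _ => tendsto_toProbabilityMeasure <|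
    tendsto_iff_edist_tendsto_0.1 tendsto_id

end P2

theorem convergesW2_iff_tendsto [CompleteSpace X] {μ : ℕ → P2 X} {μ' : P2 X} :
    ConvergesW2 μ μ' ↔ Tendsto μ atTop (𝓝 μ') := by
  rw [tendsto_iff_edist_tendsto_0]
  rfl

theorem continuous_W2 [CompleteSpace X] {W : Type*} [TopologicalSpace W] {f g : W → P2 X}
    (hf : Continuous f) (hg : Continuous g) : Continuous fun w => W2 (f w) (g w) :=
  hf.edist hg

theorem UpperSemicontinuousMV.of_isClosed_graph [CompleteSpace X] {Y : Type*}
    [NormedAddCommGroup Y] [MeasurableSpace Y] [BorelSpace Y] [SecondCountableTopology Y]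
    [CompleteSpace Y] {F : P2 X → Set (P2 Y)} (hF : IsClosed {p : P2 X × P2 Y | p.2 ∈ F p.1}) :
    UpperSemicontinuousMV F := by
  intro μ ρ μ' ρ' hμ hρ hmem
  rw [convergesW2_iff_tendsto] at hμ hρ
  exact hF.mem_of_tendsto (hμ.prodMk_nhds hρ) (.of_forall hmem)

end MetricSpace

section DiracZero

variable {X : Type*} [NormedAddCommGroup X] [MeasurableSpace X] [BorelSpace X]

/-- The Dirac mass at the origin, as a reference point of `𝒫₂(X)`: the distance to it is the root
of the second moment. -/
noncomputable def P2.diracZero : P2 X where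
  toMeasure := Measure.dirac 0
  isProbabilityMeasure := inferInstance
  secondMoment_lt_top := by
    rw [lintegral_dirac' _ (by fun_prop)]
    simp

variable [SecondCountableTopology X]

theorem W2_diracZero (μ : P2 X) : W2 μ P2.diracZero = eLpNorm id 2 μ.toMeasure := by
  rw [W2_eq_iInf_eLpNorm]
  refine (iInf_congr fun ⟨γ, hγ⟩ => ?_).trans ciInf_const
  have hsnd : ∀ᵐ p ∂γ, p.2 = 0 := by
    refine ae_of_ae_map (f := Prod.snd) (p := (· = 0)) (by fun_prop) ?_
    simp [hγ.2, P2.diracZero, ae_dirac_eq]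
  rw [← eLpNorm_comp_measurePreserving aestronglyMeasurable_id
    (measurePreserving_fst_of_mem_couplings hγ)]
  refine eLpNorm_congr_ae ?_
  filter_upwards [hsnd] with p hp
  simp [hp]

end DiracZero

section Map

variable {X Y : Type*} [NormedAddCommGroup X] [NormedSpace ℝ X] [MeasurableSpace X] [BorelSpace X]
  [SecondCountableTopology X] [NormedAddCommGroup Y] [NormedSpace ℝ Y] [MeasurableSpace Y]
  [BorelSpace Y] [SecondCountableTopology Y]

/-- The push-forward `g_# μ` of a measure of `𝒫₂(X)` under a continuous linear map. -/
noncomputable def P2.map (g : X →L[ℝ] Y) (μ : P2 X) : P2 Y where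
  toMeasure := μ.toMeasure.map g
  isProbabilityMeasure := Measure.isProbabilityMeasure_map (by fun_prop)
  secondMoment_lt_top := by
    rw [lintegral_map (by fun_prop) (by fun_prop)]
    exact (memLp_two_iff_lintegral_enorm_sq_lt_top (by fun_prop)).1 (g.comp_memLp' μ.memLp_id)

theorem P2.measurePreserving_map (g : X →L[ℝ] Y) (μ : P2 X) :
    MeasurePreserving g μ.toMeasure (μ.map g).toMeasure :=
  ⟨by fun_prop, rfl⟩

theorem W2_map_le (g : X →L[ℝ] Y) (μ ν : P2 X) : W2 (μ.map g) (ν.map g) ≤ ‖g‖₊ * W2 μ ν := by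
  rw [W2_eq_iInf_eLpNorm μ ν, ENNReal.mul_iInf (by simp)]
  refine le_iInf fun ⟨γ, hγ⟩ => ?_
  calc W2 (μ.map g) (ν.map g)
      ≤ eLpNorm (g ∘ Prod.fst - g ∘ Prod.snd) 2 γ :=
        W2_le_eLpNorm_sub
          ((μ.measurePreserving_map g).comp (measurePreserving_fst_of_mem_couplings hγ))
          ((ν.measurePreserving_map g).comp (measurePreserving_snd_of_mem_couplings hγ))
    _ ≤ ‖g‖₊ * eLpNorm (Prod.fst - Prod.snd) 2 γ := by
        refine eLpNorm_le_nnreal_smul_eLpNorm_of_ae_le_mul (.of_forall fun p => ?_) 2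
        simpa using g.le_opNNNorm (p.1 - p.2)

theorem P2.continuous_map [CompleteSpace X] [CompleteSpace Y] (g : X →L[ℝ] Y) :
    Continuous (P2.map g) :=
  LipschitzWith.continuous (W2_map_le g)

end Map

section OptimalPlans

variable {X Z : Type*} [NormedAddCommGroup X] [NormedSpace ℝ X] [MeasurableSpace X] [BorelSpace X]
  [SecondCountableTopology X] [NormedAddCommGroup Z] [NormedSpace ℝ Z] [MeasurableSpace Z]
  [BorelSpace Z] [SecondCountableTopology Z]

theorem map_prodMk_mem_optimalCouplings_iff {f g : Z →L[ℝ] X} {ρ : P2 Z} {μ ν : P2 X} :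
    ρ.toMeasure.map (fun z => (f z, g z)) ∈ optimalCouplings μ ν ↔
      ρ.map f = μ ∧ ρ.map g = ν ∧ W2 (ρ.map (f - g)) P2.diracZero ≤ W2 μ ν := by
  have hcost : W2 (ρ.map (f - g)) P2.diracZero = eLpNorm (f - g) 2 ρ.toMeasure :=
    (W2_diracZero _).trans (eLpNorm_map_measure aestronglyMeasurable_id (by fun_prop))
  rw [mem_optimalCouplings_iff, map_prodMk_mem_couplings_iff (by fun_prop) (by fun_prop),
    eLpNorm_sub_map_prodMk (by fun_prop) (by fun_prop), hcost, P2.ext_iff, P2.ext_iff, and_assoc]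
  rfl

theorem map_prodMk_mem_optimalCouplingsSet_iff {f g : Z →L[ℝ] X} {ρ : P2 Z} {μ : P2 X}
    {A : Set (P2 X)} :
    ρ.toMeasure.map (fun z => (f z, g z)) ∈ optimalCouplingsSet μ A ↔
      ρ.map g ∈ A ∧ ρ.toMeasure.map (fun z => (f z, g z)) ∈ optimalCouplings μ (ρ.map g) := by
  simp only [optimalCouplingsSet, Set.mem_iUnion, exists_prop]
  refine ⟨?_, fun h => ⟨_, h⟩⟩
  rintro ⟨ν, hν, hplan⟩
  obtain rfl : ρ.map g = ν := (map_prodMk_mem_optimalCouplings_iff.1 hplan).2.1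
  exact ⟨hν, hplan⟩

theorem isClosed_setOf_map_prodMk_mem_optimalCouplingsSet [CompleteSpace X] [CompleteSpace Z]
    {W : Type*} [TopologicalSpace W] {m : W → P2 X} (hm : Continuous m) {A : W → Set (P2 X)}
    (hA : IsClosed {p : W × P2 X | p.2 ∈ A p.1}) (f g : Z →L[ℝ] X) :
    IsClosed {p : W × P2 Z |
      p.2.toMeasure.map (fun z => (f z, g z)) ∈ optimalCouplingsSet (m p.1) (A p.1)} := by
  have hmap (h : Z →L[ℝ] X) : Continuous fun p : W × P2 Z => p.2.map h :=
    (P2.continuous_map h).comp continuous_snd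
  have hm' : Continuous fun p : W × P2 Z => m p.1 := hm.comp continuous_fst
  have hopt : IsClosed {p : W × P2 Z |
      W2 (p.2.map (f - g)) P2.diracZero ≤ W2 (m p.1) (p.2.map g)} :=
    isClosed_le (continuous_W2 (hmap (f - g)) continuous_const) (continuous_W2 hm' (hmap g))
  simp only [map_prodMk_mem_optimalCouplingsSet_iff, map_prodMk_mem_optimalCouplings_iff, true_and]
  exact (hA.preimage (continuous_fst.prodMk (hmap g))).inter ((isClosed_eq (hmap f) hm').inter hopt)

end OptimalPlans

section Barycenters

open scoped NNReal

variable {X : Type*} [NormedAddCommGroup X] [MeasurableSpace X] [BorelSpace X]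
  [SecondCountableTopology X] [CompleteSpace X] {ι : Type*} [Fintype ι]

theorem mem_Bar_sum_smul_dirac_iff {w : ι → ℝ≥0} {σ : ι → P2 X} {ν : P2 X} :
    ν ∈ Bar (∑ i, w i • Measure.dirac (σ i)) ↔
      ∀ ν', ∑ i, w i * nndist (σ i) ν ^ 2 ≤ ∑ i, w i * nndist (σ i) ν' ^ 2 := by
  have hcost (ν : P2 X) : ∫⁻ τ, W2 τ ν ^ 2 ∂(∑ i, w i • Measure.dirac (σ i)) =
      ↑(∑ i, w i * nndist (σ i) ν ^ 2) := by
    rw [lintegral_finsetSum_measure, ENNReal.ofNNReal_finsetSum]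
    refine Finset.sum_congr rfl fun i _ => ?_
    rw [lintegral_smul_measure, lintegral_dirac, ENNReal.smul_def, smul_eq_mul, ENNReal.coe_mul,
      ENNReal.coe_pow, ← edist_nndist, P2.edist_eq_W2]
  simp only [Bar, Set.mem_ofPred_eq, isMinOn_univ_iff, hcost, ENNReal.coe_le_coe]

theorem isClosed_setOf_mem_Bar_sum_smul_dirac {W : Type*} [TopologicalSpace W] {w : ι → W → ℝ≥0}
    {σ : ι → W → P2 X} (hw : ∀ i, Continuous (w i)) (hσ : ∀ i, Continuous (σ i)) :
    IsClosed {p : W × P2 X | p.2 ∈ Bar (∑ i, w i p.1 • Measure.dirac (σ i p.1))} := by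
  simp only [mem_Bar_sum_smul_dirac_iff, Set.ofPred_forall]
  exact isClosed_iInter fun ν' => isClosed_le (by fun_prop) (by fun_prop)

variable {d N : ℕ}

theorem weighted_empirical (lam : P2 (Rd d) →ᵇ ℝ) (μ : P2 (RdN d N)) :
    weighted lam (empirical μ) =
      ∑ i, ((lam (μ.marginal i)).toNNReal / N) • Measure.dirac (μ.marginal i) := by
  rw [weighted, empirical, withDensity_smul_measure, ← Measure.sum_fintype, withDensity_sum,
    Measure.sum_fintype, Finset.smul_sum]
  refine Finset.sum_congr rfl fun i _ => ?_
  have hN : (N : ℝ≥0) ≠ 0 := mod_cast i.pos.ne'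
  rw [dirac_withDensity, smul_smul, ENNReal.smul_def, ENNReal.coe_div hN, ENNReal.div_eq_inv_mul,
    ENNReal.coe_natCast]
  rfl

theorem P2.continuous_marginal (i : Fin N) :
    Continuous fun μ : P2 (RdN d N) => μ.marginal i :=
  P2.continuous_map (PiLp.proj 2 (fun _ : Fin N => Rd d) i : RdN d N →L[ℝ] Rd d)

theorem isClosed_setOf_mem_Bar_weighted_empirical (lam : P2 (Rd d) →ᵇ ℝ) :
    IsClosed {p : P2 (RdN d N) × P2 (Rd d) | p.2 ∈ Bar (weighted lam (empirical p.1))} := by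
  simp only [weighted_empirical]
  refine isClosed_setOf_mem_Bar_sum_smul_dirac
    (w := fun i μ => (lam (P2.marginal μ i)).toNNReal / N) (σ := fun i μ => P2.marginal μ i)
    (fun i => ?_) P2.continuous_marginal
  exact (continuous_real_toNNReal.comp (lam.continuous.comp (P2.continuous_marginal i))).div_const _

end Barycenters

section TangentPlans

variable {d N : ℕ}

/-- The base point of the `i`-th component of a tangent vector of `(ℝᵈ)ᴺ`. -/
noncomputable def basePoint (i : Fin N) : TRdN d N →L[ℝ] Rd d :=
  (PiLp.proj 2 (fun _ : Fin N => Rd d) i).comp (WithLp.fstL 2 ℝ (RdN d N) (RdN d N))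

/-- The velocity of the `i`-th component of a tangent vector of `(ℝᵈ)ᴺ`. -/
noncomputable def velocity (i : Fin N) : TRdN d N →L[ℝ] Rd d :=
  (PiLp.proj 2 (fun _ : Fin N => Rd d) i).comp (WithLp.sndL 2 ℝ (RdN d N) (RdN d N))

/-- The end point `xᵢ + vᵢ` of the `i`-th component of a tangent vector `(x, v)` of `(ℝᵈ)ᴺ`. -/
noncomputable def endPoint (i : Fin N) : TRdN d N →L[ℝ] Rd d :=
  basePoint i + velocity i

/-- The transport plan of the `i`-th component of a measure on `T(ℝᵈ)ᴺ`: the joint law of its base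
point and its end point. It undoes `velocityPlan`. -/
noncomputable def componentPlan (ρ : Measure (TRdN d N)) (i : Fin N) : Measure (Rd d × Rd d) :=
  ρ.map fun z => (basePoint i z, endPoint i z)

/-- Independence of the `N` components under a measure on `T(ℝᵈ)ᴺ`: it is the tensor product of
their laws. -/
def HasIndependentComponents (ρ : Measure (TRdN d N)) : Prop :=
  ρ = tensor fun i => velocityPlan (componentPlan ρ i)

theorem velocityPlan_componentPlan (ρ : Measure (TRdN d N)) (i : Fin N) :
    velocityPlan (componentPlan ρ i) = ρ.map fun z => (basePoint i z, velocity i z) := by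
  rw [velocityPlan, componentPlan, Measure.map_map (by fun_prop) (by fun_prop)]
  congr 1
  ext z : 1
  simp [endPoint]

theorem continuous_tangentIdent : Continuous (tangentIdent (d := d) (N := N)) := by
  unfold tangentIdent
  fun_prop

theorem componentPlan_tensor_velocityPlan (γ : Fin N → Measure (Rd d × Rd d))
    [∀ i, IsProbabilityMeasure (γ i)] (i : Fin N) :
    componentPlan (tensor fun i => velocityPlan (γ i)) i = γ i := by
  have (i : Fin N) : IsProbabilityMeasure (velocityPlan (γ i)) :=
    Measure.isProbabilityMeasure_map (by fun_prop)
  have hadd : Measurable fun p : Rd d × Rd d => (p.1, p.1 + p.2) := by fun_prop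
  have heval := measurePreserving_eval (fun i => velocityPlan (γ i)) i
  calc componentPlan (tensor fun i => velocityPlan (γ i)) i
      = ((Measure.pi fun i => velocityPlan (γ i)).map fun z => z i).map
          fun p => (p.1, p.1 + p.2) := by
        rw [componentPlan, tensor,
          Measure.map_map (by fun_prop) continuous_tangentIdent.measurable,
          Measure.map_map hadd heval.measurable]
        rfl
    _ = (velocityPlan (γ i)).map fun p => (p.1, p.1 + p.2) := by rw [heval.map_eq]
    _ = (γ i).map fun p => p := by
        rw [velocityPlan, Measure.map_map hadd (by fun_prop)]
        congr 1
        ext p : 1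
        simp
    _ = γ i := Measure.map_id

theorem eq_tensor_velocityPlan_iff {ρ : Measure (TRdN d N)} {γ : Fin N → Measure (Rd d × Rd d)}
    [∀ i, IsProbabilityMeasure (γ i)] :
    ρ = tensor (fun i => velocityPlan (γ i)) ↔
      componentPlan ρ = γ ∧ HasIndependentComponents ρ := by
  constructor
  · intro h
    have hplan : componentPlan ρ = γ := by
      rw [h]
      exact funext (componentPlan_tensor_velocityPlan γ)
    exact ⟨hplan, by rwa [HasIndependentComponents, hplan]⟩
  · rintro ⟨rfl, h⟩
    exact h

theorem isClosed_setOf_hasIndependentComponents :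
    IsClosed {ρ : P2 (TRdN d N) | HasIndependentComponents ρ.toMeasure} := by
  have hT := continuous_tangentIdent (d := d) (N := N)
  let productOfComponents (ρ : ProbabilityMeasure (TRdN d N)) : ProbabilityMeasure (TRdN d N) :=
    (ProbabilityMeasure.pi fun i : Fin N => ρ.map
      (f := fun z => (basePoint i z, velocity i z)) (by fun_prop)).map hT.aemeasurable
  have hcont : Continuous productOfComponents :=
    (ProbabilityMeasure.continuous_map hT).comp <| ProbabilityMeasure.continuous_pi.comp <|
      continuous_pi fun i => ProbabilityMeasure.continuous_map (by fun_prop)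
  have hiff (ρ : P2 (TRdN d N)) : HasIndependentComponents ρ.toMeasure ↔
      ρ.toProbabilityMeasure = productOfComponents ρ.toProbabilityMeasure := by
    simp only [HasIndependentComponents, velocityPlan_componentPlan]
    exact ⟨fun h => Subtype.ext h, fun h => congrArg Subtype.val h⟩
  simp only [hiff]
  exact isClosed_eq P2.continuous_toProbabilityMeasure
    (hcont.comp P2.continuous_toProbabilityMeasure)

end TangentPlans

section VectorFields

variable {d N : ℕ} {lam : P2 (Rd d) →ᵇ ℝ} {μ : P2 (RdN d N)} {ρ : P2 (TRdN d N)}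

theorem mem_multiVF_iff :
    ρ ∈ multiVF lam μ ↔
      (∀ i, componentPlan ρ.toMeasure i ∈
        optimalCouplingsSet (μ.marginal i) (Bar (weighted lam (empirical μ)))) ∧
      HasIndependentComponents ρ.toMeasure := by
  constructor
  · rintro ⟨γ, hγ, hρ⟩
    have (i : Fin N) : IsProbabilityMeasure (γ i) := by
      obtain ⟨ν, -, hν⟩ := Set.mem_iUnion₂.1 (hγ i)
      exact isProbabilityMeasure_of_mem_couplings hν.1
    obtain ⟨rfl, hind⟩ := eq_tensor_velocityPlan_iff.1 hρ
    exact ⟨hγ, hind⟩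
  · rintro ⟨hopt, hind⟩
    exact ⟨_, hopt, hind⟩

theorem exists_mem_Bar_forall_map_endPoint_eq (hρ : ρ ∈ multiVF lam μ)
    (h : ∀ i j, ρ.map (endPoint i) = ρ.map (endPoint j)) :
    ∃ ν ∈ Bar (weighted lam (empirical μ)), ∀ i, ρ.map (endPoint i) = ν := by
  rcases isEmpty_or_nonempty (Fin N) with hN | ⟨⟨j⟩⟩
  · exact ⟨P2.diracZero, by simp [weighted_empirical, Bar, isMinOn_univ_iff], hN.elim⟩
  · exact ⟨_, (map_prodMk_mem_optimalCouplingsSet_iff.1 ((mem_multiVF_iff.1 hρ).1 j)).1,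
      fun i => h i j⟩

theorem mem_multiVFCommon_iff :
    ρ ∈ multiVFCommon lam μ ↔
      ρ ∈ multiVF lam μ ∧ ∀ i j, ρ.map (endPoint i) = ρ.map (endPoint j) := by
  constructor
  · rintro ⟨ν, hν, γ, hγ, hρ⟩
    have (i : Fin N) : IsProbabilityMeasure (γ i) :=
      isProbabilityMeasure_of_mem_couplings (hγ i).1
    obtain ⟨rfl, -⟩ := eq_tensor_velocityPlan_iff.1 hρ
    have hend (i : Fin N) : ρ.map (endPoint i) = ν :=
      (map_prodMk_mem_optimalCouplings_iff.1 (hγ i)).2.1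
    exact ⟨⟨_, fun i => Set.mem_biUnion hν (hγ i), hρ⟩, fun i j => (hend i).trans (hend j).symm⟩
  · rintro ⟨hρ, h⟩
    obtain ⟨ν, hν, hend⟩ := exists_mem_Bar_forall_map_endPoint_eq hρ h
    obtain ⟨hopt, hind⟩ := mem_multiVF_iff.1 hρ
    exact ⟨ν, hν, _, fun i => hend i ▸ (map_prodMk_mem_optimalCouplingsSet_iff.1 (hopt i)).2, hind⟩

theorem isClosed_graph_multiVF (lam : P2 (Rd d) →ᵇ ℝ) :
    IsClosed {p : P2 (RdN d N) × P2 (TRdN d N) | p.2 ∈ multiVF lam p.1} := by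
  simp only [mem_multiVF_iff, Set.ofPred_and, Set.ofPred_forall]
  exact (isClosed_iInter fun i => isClosed_setOf_map_prodMk_mem_optimalCouplingsSet
    (A := fun μ => Bar (weighted lam (empirical μ))) (P2.continuous_marginal i)
    (isClosed_setOf_mem_Bar_weighted_empirical lam) (basePoint i) (endPoint i)).inter
    (isClosed_setOf_hasIndependentComponents.preimage continuous_snd)

theorem isClosed_graph_multiVFCommon (lam : P2 (Rd d) →ᵇ ℝ) :
    IsClosed {p : P2 (RdN d N) × P2 (TRdN d N) | p.2 ∈ multiVFCommon lam p.1} := by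
  simp only [mem_multiVFCommon_iff, Set.ofPred_and, Set.ofPred_forall]
  exact (isClosed_graph_multiVF lam).inter <| isClosed_iInter fun i => isClosed_iInter fun j =>
    isClosed_eq ((P2.continuous_map _).comp continuous_snd)
      ((P2.continuous_map _).comp continuous_snd)

end VectorFields

/-- The multivalued probability vector field `𝒱` is upper semicontinuous, whether the barycenter is
chosen separately for each agent or is common to all agents. -/
theorem proposition3p1 (d N : ℕ) (lam : P2 (Rd d) →ᵇ ℝ) (hlam : ∀ σ, 0 < lam σ) :
    UpperSemicontinuousMV (multiVF (N := N) lam) ∧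
      UpperSemicontinuousMV (multiVFCommon (N := N) lam) :=
  ⟨.of_isClosed_graph (isClosed_graph_multiVF lam),
    .of_isClosed_graph (isClosed_graph_multiVFCommon lam)⟩
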